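/- For Banach spaces $X,Y$ over $\mathbb{R}$, a linear isometry (not necessarily onto) $T\colon X\to Y$ is called a U-embedding if for every $x^*\in X^*$ with $\|x^*\|=1$ there is exactly one $y^*\in Y^*$ such that $y^*\circ T=x^*$ and $\|y^*\|=\|x^*\|$; and $X$ can be U-embedded into $Y$ if there is a U-embedding $T\colon X\to Y$. A point $p$ of a topological space $K$ is a $G_\delta$-point if $\{p\}$ is a $G_\delta$-set, i.e. a countable intersection of open subsets of $K$. Proposition. Let $N$ be a natural number, let $K$ be a compact Hausdorff space, and let $C(K)$ be the space of continuous real-valued functions on $K$ with the maximum norm. Then $\ell_\infty^N$ (that is, $\mathbb{R}^N$ with the maximum norm) can be U-embedded into $C(K)$ if and only if $K$ contains at least $N$ distinct $G_\delta$-points. -/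

import Mathlib

/-!
A norm-one functional on `C(K)` that attains its norm at `f` kills every `g` vanishing on the peak
set `{|f| = ‖f‖}`: for every `ε > 0` the norm of `f ± t • g` is at most `‖f‖ + t * ε` for some
`t > 0`.

Disjoint bumps peaking exactly at `N` distinct `G_δ`-points span an isometric copy of `ℓ_∞^N` in
which every nonzero element peaks only at these points. Evaluation at the points is a norm-one left
inverse, and a Hahn–Banach extension, attaining its norm in the copy, kills its kernel; so the
extension is unique.

Conversely, an isometry `T` forces the functional `a ↦ T a x` to be `±` the `i`-th coordinate
whenever `|T e_i x| = 1`, because the dual norm of `ℓ_∞^N` is the `ℓ_1` norm. Up to sign, evaluation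
at such an `x` extends the `i`-th coordinate, so uniqueness makes `x` the only peak of `T e_i`, and
the peak set of a continuous function is a `G_δ`.
-/

/-- `y'` is a Hahn--Banach extension of `x'` through the linear isometry `T : X → Y`:
`T^* y' = x'` and `‖y'‖ = ‖x'‖`. -/
def IsHahnBanachExtension {X Y : Type*} [NormedAddCommGroup X] [NormedSpace ℝ X]
    [NormedAddCommGroup Y] [NormedSpace ℝ Y] (T : X →ₗᵢ[ℝ] Y)
    (x' : StrongDual ℝ X) (y' : StrongDual ℝ Y) : Prop :=
  y'.comp T.toContinuousLinearMap = x' ∧ ‖y'‖ = ‖x'‖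

/-- A linear isometry (into) `T : X → Y` is a U-embedding if every functional of norm one on `X`
has a unique Hahn--Banach extension through `T`. -/
def IsUEmbedding {X Y : Type*} [NormedAddCommGroup X] [NormedSpace ℝ X]
    [NormedAddCommGroup Y] [NormedSpace ℝ Y] (T : X →ₗᵢ[ℝ] Y) : Prop :=
  ∀ x' : StrongDual ℝ X, ‖x'‖ = 1 → ∃! y' : StrongDual ℝ Y, IsHahnBanachExtension T x' y'

/-- `X` can be U-embedded into `Y`. -/
def UEmbeddable (X Y : Type*) [NormedAddCommGroup X] [NormedSpace ℝ X]
    [NormedAddCommGroup Y] [NormedSpace ℝ Y] : Prop :=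
  ∃ T : X →ₗᵢ[ℝ] Y, IsUEmbedding T

/-- The set of `G_δ`-points of a topological space. -/
def gDeltaPoints (K : Type*) [TopologicalSpace K] : Set K :=
  {p | IsGδ ({p} : Set K)}

section NormedSpace

variable {X Y : Type*} [NormedAddCommGroup X] [NormedSpace ℝ X]
  [NormedAddCommGroup Y] [NormedSpace ℝ Y]

namespace IsHahnBanachExtension

variable {T : X →ₗᵢ[ℝ] Y} {x' : StrongDual ℝ X} {y' : StrongDual ℝ Y}

theorem apply_eq (h : IsHahnBanachExtension T x' y') (a : X) : y' (T a) = x' a :=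
  DFunLike.congr_fun h.1 a

theorem of_norm_le (hcomp : y'.comp T.toContinuousLinearMap = x') (hnorm : ‖y'‖ ≤ ‖x'‖) :
    IsHahnBanachExtension T x' y' := by
  refine ⟨hcomp, hnorm.antisymm ?_⟩
  rw [← hcomp]
  exact (y'.opNorm_comp_le _).trans
    (mul_le_of_le_one_right (norm_nonneg _) T.norm_toContinuousLinearMap_le)

end IsHahnBanachExtension

theorem isUEmbedding_of_leftInverse {T : X →ₗᵢ[ℝ] Y} {P : Y →L[ℝ] X} (hP : ‖P‖ ≤ 1)
    (hPT : Function.LeftInverse P T)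
    (hker : ∀ x' y', ‖x'‖ = 1 → IsHahnBanachExtension T x' y' → ∀ g, P g = 0 → y' g = 0) :
    IsUEmbedding T := by
  intro x' hx'
  refine ⟨x'.comp P, .of_norm_le ?_ ?_, fun y' hy' => ?_⟩
  · ext a
    exact congrArg x' (hPT a)
  · exact (x'.opNorm_comp_le P).trans (mul_le_of_le_one_right (norm_nonneg _) hP)
  · ext g
    have hg : y' (g - T (P g)) = 0 := hker x' y' hx' hy' _ (by rw [map_sub, hPT, sub_self])
    rwa [map_sub, hy'.apply_eq, sub_eq_zero] at hg

theorem exists_norm_le_one_apply_eq_norm [FiniteDimensional ℝ X] (x' : StrongDual ℝ X) :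
    ∃ s : X, ‖s‖ ≤ 1 ∧ x' s = ‖x'‖ := by
  have := FiniteDimensional.proper ℝ X
  obtain ⟨s, hs, hmax⟩ := (isCompact_closedBall (0 : X) 1).exists_sSup_image_eq
    ⟨0, by simp⟩ (f := fun x => ‖x' x‖) (by fun_prop)
  rw [x'.sSup_unitClosedBall_eq_norm, Real.norm_eq_abs] at hmax
  rw [mem_closedBall_zero_iff] at hs
  rcases (abs_eq (norm_nonneg x')).1 hmax.symm with h | h
  · exact ⟨s, hs, h⟩
  · exact ⟨-s, by rwa [norm_neg], by rw [map_neg, h, neg_neg]⟩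

end NormedSpace

section ContinuousMap

variable {K E : Type*} [TopologicalSpace K] [CompactSpace K] [SeminormedAddCommGroup E]

theorem exists_norm_apply_eq_norm [Nonempty K] (f : C(K, E)) : ∃ x, ‖f x‖ = ‖f‖ := by
  obtain ⟨x, -, hx⟩ := isCompact_univ.exists_isMaxOn Set.univ_nonempty
    (f := fun x => ‖f x‖) (by fun_prop)
  exact ⟨x, (f.norm_coe_le_norm x).antisymm
    ((f.norm_le (norm_nonneg _)).2 fun y => hx (Set.mem_univ y))⟩

variable [NormedSpace ℝ E]

theorem norm_evalCLM_le_one (x : K) : ‖(ContinuousMap.evalCLM ℝ x : C(K, E) →L[ℝ] E)‖ ≤ 1 :=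
  ContinuousLinearMap.opNorm_le_bound _ zero_le_one fun f => by
    simpa using f.norm_coe_le_norm x

theorem exists_pos_norm_add_smul_le {f g : C(K, E)} (hg : ∀ x, ‖f x‖ = ‖f‖ → g x = 0)
    {ε : ℝ} (hε : 0 < ε) : ∃ t > 0, ‖f + t • g‖ ≤ ‖f‖ + t * ε := by
  -- On the compact set `{ε ≤ ‖g‖}` the norm of `f` stays a distance `δ` below its maximum, which
  -- leaves room for `t • g` once `t` is small.
  have hcompact : IsCompact {x | ε ≤ ‖g x‖} :=
    (isClosed_le continuous_const (by fun_prop)).isCompact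
  have hlt : ∀ x ∈ {x | ε ≤ ‖g x‖}, 0 < ‖f‖ - ‖f x‖ := fun x hx =>
    sub_pos.2 <| (f.norm_coe_le_norm x).lt_of_ne fun h => by
      rw [Set.mem_ofPred_eq, hg x h, norm_zero] at hx
      exact hε.not_ge hx
  obtain ⟨δ, hδ, hgap⟩ := hcompact.exists_forall_le' (by fun_prop) hlt
  have hpos : 0 < ‖g‖ + 1 := by positivity
  have ht : 0 < δ / (‖g‖ + 1) := div_pos hδ hpos
  refine ⟨δ / (‖g‖ + 1), ht, (ContinuousMap.norm_le _ (by positivity)).2 fun x => ?_⟩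
  generalize htdef : δ / (‖g‖ + 1) = t at ht ⊢
  have hbound : ‖(f + t • g) x‖ ≤ ‖f x‖ + t * ‖g x‖ := by
    simpa [norm_smul, abs_of_pos ht] using norm_add_le (f x) (t • g x)
  rcases lt_or_ge ‖g x‖ ε with hx | hx
  · exact hbound.trans (by gcongr; exact f.norm_coe_le_norm x)
  · have htδ : t * ‖g x‖ ≤ δ := calc
      t * ‖g x‖ ≤ t * (‖g‖ + 1) := by gcongr; linarith [g.norm_coe_le_norm x]
      _ = δ := by rw [← htdef, div_mul_cancel₀ _ hpos.ne']
    linarith [hgap x hx, mul_pos ht hε]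

theorem apply_nonpos_of_vanishes_on_peak {y' : StrongDual ℝ C(K, E)} {f g : C(K, E)}
    (hf : y' f = ‖y'‖ * ‖f‖) (hg : ∀ x, ‖f x‖ = ‖f‖ → g x = 0) : y' g ≤ 0 := by
  have hle (ε : ℝ) (hε : 0 < ε) : y' g ≤ ‖y'‖ * ε := by
    obtain ⟨t, ht, hnorm⟩ := exists_pos_norm_add_smul_le hg hε
    have h : ‖y'‖ * ‖f‖ + t * y' g ≤ ‖y'‖ * ‖f‖ + t * (‖y'‖ * ε) := calc
      ‖y'‖ * ‖f‖ + t * y' g = y' (f + t • g) := by simp [hf]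
      _ ≤ ‖y'‖ * (‖f‖ + t * ε) := (le_abs_self _).trans (y'.le_opNorm_of_le hnorm)
      _ = ‖y'‖ * ‖f‖ + t * (‖y'‖ * ε) := by ring
    exact le_of_mul_le_mul_left (le_of_add_le_add_left h) ht
  have hlim : Filter.Tendsto (fun ε : ℝ => ‖y'‖ * ε) (nhdsWithin 0 (Set.Ioi 0)) (nhds 0) :=
    tendsto_nhdsWithin_of_tendsto_nhds <| (continuous_const_mul ‖y'‖).tendsto' 0 0 (mul_zero _)
  exact ge_of_tendsto hlim (Filter.eventually_of_mem self_mem_nhdsWithin hle)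

theorem apply_eq_zero_of_vanishes_on_peak {y' : StrongDual ℝ C(K, E)} {f g : C(K, E)}
    (hf : y' f = ‖y'‖ * ‖f‖) (hg : ∀ x, ‖f x‖ = ‖f‖ → g x = 0) : y' g = 0 := by
  refine (apply_nonpos_of_vanishes_on_peak hf hg).antisymm ?_
  have hneg : y' (-g) ≤ 0 :=
    apply_nonpos_of_vanishes_on_peak hf fun x hx => by simp [hg x hx]
  rwa [map_neg, neg_nonpos] at hneg

end ContinuousMap

theorem isUEmbedding_of_vanishes_on_peaks {X K E : Type*} [NormedAddCommGroup X]
    [NormedSpace ℝ X] [FiniteDimensional ℝ X] [TopologicalSpace K] [CompactSpace K]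
    [NormedAddCommGroup E] [NormedSpace ℝ E] {T : X →ₗᵢ[ℝ] C(K, E)} {P : C(K, E) →L[ℝ] X}
    (hP : ‖P‖ ≤ 1) (hPT : Function.LeftInverse P T)
    (hpeak : ∀ s ≠ 0, ∀ g, P g = 0 → ∀ x, ‖T s x‖ = ‖T s‖ → g x = 0) : IsUEmbedding T := by
  refine isUEmbedding_of_leftInverse hP hPT fun x' y' hx' hy' g hg => ?_
  obtain ⟨s, hs, hxs⟩ := exists_norm_le_one_apply_eq_norm x'
  have hs0 : s ≠ 0 := by
    rintro rfl
    simp [hx'] at hxs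
  have hnorm : y' (T s) = ‖y'‖ * ‖T s‖ := by
    refine ((le_abs_self _).trans (y'.le_opNorm (T s))).antisymm ?_
    rw [hy'.apply_eq, hxs, hy'.2, T.norm_map]
    exact mul_le_of_le_one_right (norm_nonneg _) hs
  exact apply_eq_zero_of_vanishes_on_peak hnorm (hpeak s hs0 g hg)

/-- A family of disjointly supported functions with values in `[0, 1]`, the `i`-th of which attains
the value `1` exactly at `p i`. The coordinate vectors of `ℓ_∞^ι` are sent to such functions. -/
structure IsDisjointPeakFamily {ι K : Type*} [TopologicalSpace K] (p : ι → K)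
    (f : ι → C(K, ℝ)) : Prop where
  mem_Icc : ∀ i x, f i x ∈ Set.Icc (0 : ℝ) 1
  eq_one_iff : ∀ i x, f i x = 1 ↔ x = p i
  eq_of_ne_zero : ∀ i j x, f i x ≠ 0 → f j x ≠ 0 → i = j

theorem exists_isDisjointPeakFamily {ι K : Type*} [Finite ι] [TopologicalSpace K]
    [LocallyCompactSpace K] [T2Space K] {p : ι → K} (hp : Function.Injective p)
    (hG : ∀ i, IsGδ {p i}) : ∃ f, IsDisjointPeakFamily p f := by
  obtain ⟨U, hU, hdisj⟩ := (Set.finite_range p).t2_separation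
  have hmem (i : ι) : p i ∈ U (p i) := (hU (p i)).1
  have hpeak (i : ι) := exists_continuous_one_zero_of_isCompact_of_isGδ isCompact_singleton
    (hG i) (hU (p i)).2.isClosed_compl (Set.disjoint_singleton_left.2 fun h => h (hmem i))
  choose f hone hzero _ hIcc using hpeak
  have mem_of_ne_zero (i : ι) (x : K) (hx : f i x ≠ 0) : x ∈ U (p i) :=
    by_contra fun h => hx (hzero i h)
  refine ⟨f, hIcc, fun i x => (Set.ext_iff.1 (hone i) x).symm, fun i j x hi hj => ?_⟩
  by_contra hij
  exact Set.disjoint_left.1 (hdisj ⟨i, rfl⟩ ⟨j, rfl⟩ (hp.ne hij))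
    (mem_of_ne_zero i x hi) (mem_of_ne_zero j x hj)

/-- Evaluation at the points `p i`, as a continuous linear map. It serves as the norm-one left
inverse of the embedding built from a disjoint peak family. -/
def pointEvaluation {ι K : Type*} [TopologicalSpace K] (p : ι → K) : C(K, ℝ) →L[ℝ] (ι → ℝ) :=
  ContinuousLinearMap.pi fun i => ContinuousMap.evalCLM ℝ (p i)

theorem norm_pointEvaluation_le_one {ι K : Type*} [Fintype ι] [TopologicalSpace K]
    [CompactSpace K] (p : ι → K) : ‖pointEvaluation p‖ ≤ 1 :=
  ContinuousLinearMap.opNorm_le_bound _ zero_le_one fun g => by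
    rw [one_mul]
    exact (pi_norm_le_iff_of_nonneg (norm_nonneg g)).2 fun i => g.norm_coe_le_norm (p i)

namespace IsDisjointPeakFamily

variable {ι K : Type*} [Fintype ι] [TopologicalSpace K] {p : ι → K} {f : ι → C(K, ℝ)}

theorem linearCombination_apply (h : IsDisjointPeakFamily p f) {i : ι} {x : K}
    (hx : f i x ≠ 0) (a : ι → ℝ) : Fintype.linearCombination ℝ f a x = a i * f i x := by
  rw [Fintype.linearCombination_apply, ContinuousMap.sum_apply]
  refine Finset.sum_eq_single_of_mem i (Finset.mem_univ i) fun j _ hji => ?_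
  have hj : f j x = 0 := by_contra fun hj => hji (h.eq_of_ne_zero j i x hj hx)
  simp [hj]

theorem leftInverse_pointEvaluation (h : IsDisjointPeakFamily p f) :
    Function.LeftInverse (pointEvaluation p) (Fintype.linearCombination ℝ f) := by
  intro a
  ext i
  have hi : f i (p i) = 1 := (h.eq_one_iff i _).2 rfl
  change Fintype.linearCombination ℝ f a (p i) = a i
  rw [h.linearCombination_apply (hi.trans_ne one_ne_zero), hi, mul_one]

theorem exists_norm_linearCombination_apply_le (h : IsDisjointPeakFamily p f) {a : ι → ℝ} {x : K}
    (hx : Fintype.linearCombination ℝ f a x ≠ 0) :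
    ∃ i, ‖Fintype.linearCombination ℝ f a x‖ ≤ ‖a‖ * f i x := by
  obtain ⟨i, hi⟩ : ∃ i, f i x ≠ 0 := by
    contrapose! hx
    simp [Fintype.linearCombination_apply, ContinuousMap.sum_apply, hx]
  refine ⟨i, ?_⟩
  rw [h.linearCombination_apply hi, norm_mul, Real.norm_of_nonneg (h.mem_Icc i x).1]
  exact mul_le_mul_of_nonneg_right (norm_le_pi_norm a i) (h.mem_Icc i x).1

theorem mem_range_of_norm_linearCombination_apply_eq (h : IsDisjointPeakFamily p f) {a : ι → ℝ}
    (ha : a ≠ 0) {x : K} (hx : ‖Fintype.linearCombination ℝ f a x‖ = ‖a‖) :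
    x ∈ Set.range p := by
  have hpos : 0 < ‖a‖ := norm_pos_iff.2 ha
  obtain ⟨i, hi⟩ := h.exists_norm_linearCombination_apply_le (norm_pos_iff.1 (hx ▸ hpos))
  rw [hx] at hi
  have hone : f i x = 1 := (h.mem_Icc i x).2.antisymm (le_of_mul_le_mul_left (by simpa) hpos)
  exact ⟨i, ((h.eq_one_iff i x).1 hone).symm⟩

variable [CompactSpace K]

theorem norm_linearCombination (h : IsDisjointPeakFamily p f) (a : ι → ℝ) :
    ‖Fintype.linearCombination ℝ f a‖ = ‖a‖ := by
  refine ((ContinuousMap.norm_le _ (norm_nonneg a)).2 fun x => ?_).antisymm ?_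
  · by_cases hx : Fintype.linearCombination ℝ f a x = 0
    · simp [hx]
    · obtain ⟨i, hi⟩ := h.exists_norm_linearCombination_apply_le hx
      exact hi.trans (mul_le_of_le_one_right (norm_nonneg a) (h.mem_Icc i x).2)
  · simpa only [h.leftInverse_pointEvaluation a, one_mul] using
      (pointEvaluation p).le_of_opNorm_le (norm_pointEvaluation_le_one p)
        (Fintype.linearCombination ℝ f a)

/-- The isometric embedding `a ↦ ∑ i, a i • f i` of `ℓ_∞^ι` into `C(K)` given by a disjoint peak
family `f`. -/
noncomputable def linearIsometry (h : IsDisjointPeakFamily p f) : (ι → ℝ) →ₗᵢ[ℝ] C(K, ℝ) where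
  toLinearMap := Fintype.linearCombination ℝ f
  norm_map' := h.norm_linearCombination

theorem isUEmbedding_linearIsometry (h : IsDisjointPeakFamily p f) :
    IsUEmbedding h.linearIsometry := by
  refine isUEmbedding_of_vanishes_on_peaks (T := h.linearIsometry)
    (norm_pointEvaluation_le_one p) h.leftInverse_pointEvaluation fun a ha g hg x hx => ?_
  rw [h.linearIsometry.norm_map] at hx
  obtain ⟨i, rfl⟩ := h.mem_range_of_norm_linearCombination_apply_eq ha hx
  exact congrFun hg i

end IsDisjointPeakFamily

section PiDual

variable {ι : Type*} [Fintype ι]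

theorem norm_proj_eq_one (i : ι) :
    ‖(ContinuousLinearMap.proj i : StrongDual ℝ (ι → ℝ))‖ = 1 := by
  classical
  refine (ContinuousLinearMap.opNorm_le_bound _ zero_le_one fun a => ?_).antisymm ?_
  · simpa using norm_le_pi_norm a i
  · simpa [Pi.norm_single] using
      (ContinuousLinearMap.proj i : StrongDual ℝ (ι → ℝ)).le_opNorm (Pi.single i 1)

variable [DecidableEq ι]

theorem sum_abs_apply_single_le_norm (φ : StrongDual ℝ (ι → ℝ)) :
    ∑ i, |φ (Pi.single i 1)| ≤ ‖φ‖ := by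
  set s : ι → ℝ := fun i => (SignType.sign (φ (Pi.single i 1)) : ℝ) with hs
  have hs_norm : ‖s‖ ≤ 1 := (pi_norm_le_iff_of_nonneg zero_le_one).2 fun i => by
    rcases lt_trichotomy (φ (Pi.single i 1)) 0 with h | h | h <;> simp [hs, h]
  calc ∑ i, |φ (Pi.single i 1)| = ∑ i, s i * φ (Pi.single i 1) := by simp [hs, sign_mul_self]
    _ = φ s := by
      conv_rhs => rw [pi_eq_sum_univ' s]
      simp only [map_sum, map_smul, smul_eq_mul]
    _ ≤ ‖φ‖ := (le_abs_self _).trans (φ.unit_le_opNorm s hs_norm)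

theorem eq_smul_proj_of_norm_le {φ : StrongDual ℝ (ι → ℝ)} {i : ι}
    (h : ‖φ‖ ≤ |φ (Pi.single i 1)|) :
    φ = φ (Pi.single i 1) • ContinuousLinearMap.proj i := by
  have hzero (j : ι) (hj : j ≠ i) : φ (Pi.single j 1) = 0 := by
    have hpair := Finset.sum_le_sum_of_subset_of_nonneg (Finset.subset_univ {i, j})
      fun k _ _ => abs_nonneg (φ (Pi.single k 1))
    rw [Finset.sum_pair hj.symm] at hpair
    exact abs_nonpos_iff.1 (by linarith [sum_abs_apply_single_le_norm φ])
  refine ContinuousLinearMap.coe_injective (LinearMap.pi_ext' fun j => LinearMap.ext_ring ?_)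
  rcases eq_or_ne j i with rfl | hj
  · simp
  · simp [hzero j hj, hj.symm]

end PiDual

section LinearIsometry

variable {ι K : Type*} [Fintype ι] [DecidableEq ι] [TopologicalSpace K] [CompactSpace K]
  (T : (ι → ℝ) →ₗᵢ[ℝ] C(K, ℝ)) {i j : ι} {x y : K}

theorem exists_abs_apply_single_eq_one (i : ι) : ∃ x, |T (Pi.single i 1) x| = 1 := by
  have hnorm : ‖T (Pi.single i 1)‖ = 1 := by rw [T.norm_map, Pi.norm_single, norm_one]
  have : Nonempty K := by
    by_contra! hK
    simp [Subsingleton.elim (T (Pi.single i 1)) 0] at hnorm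
  obtain ⟨x, hx⟩ := exists_norm_apply_eq_norm (T (Pi.single i 1))
  exact ⟨x, hx.trans hnorm⟩

variable {T}

theorem evalCLM_comp_eq_smul_proj (hx : |T (Pi.single i 1) x| = 1) :
    (ContinuousMap.evalCLM ℝ x).comp T.toContinuousLinearMap =
      T (Pi.single i 1) x • (ContinuousLinearMap.proj i : StrongDual ℝ (ι → ℝ)) := by
  refine eq_smul_proj_of_norm_le (le_trans ?_ hx.ge)
  exact (ContinuousLinearMap.opNorm_comp_le _ _).trans <|
    mul_le_one₀ (norm_evalCLM_le_one x) (norm_nonneg _) T.norm_toContinuousLinearMap_le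

theorem index_eq_of_abs_apply_single_eq_one (hi : |T (Pi.single i 1) x| = 1)
    (hj : |T (Pi.single j 1) x| = 1) : i = j := by
  by_contra hij
  have hzero : T (Pi.single j 1) x = 0 := by
    simpa [hij] using DFunLike.congr_fun (evalCLM_comp_eq_smul_proj hi) (Pi.single j 1)
  simp [hzero] at hj

theorem isHahnBanachExtension_smul_evalCLM (hx : |T (Pi.single i 1) x| = 1) :
    IsHahnBanachExtension T (ContinuousLinearMap.proj i)
      (T (Pi.single i 1) x • ContinuousMap.evalCLM ℝ x) := by
  refine .of_norm_le ?_ ?_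
  · rw [ContinuousLinearMap.smul_comp, evalCLM_comp_eq_smul_proj hx, smul_smul,
      ← abs_mul_abs_self, hx, one_mul, one_smul]
  · rw [norm_proj_eq_one, norm_smul, Real.norm_eq_abs, hx, one_mul]
    exact norm_evalCLM_le_one x

end LinearIsometry

theorem eq_of_smul_evalCLM_eq {K : Type*} [TopologicalSpace K] [T35Space K] {x y : K} {a b : ℝ}
    (ha : a ≠ 0) (h : a • (ContinuousMap.evalCLM ℝ x : StrongDual ℝ C(K, ℝ)) =
      b • ContinuousMap.evalCLM ℝ y) : x = y := by
  have heval (g : C(K, ℝ)) : a * g x = b * g y := DFunLike.congr_fun h g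
  have hab : a = b := by simpa using heval 1
  by_contra hxy
  obtain ⟨g, hg, hne⟩ := separatesPoints_continuous_of_t35Space hxy
  exact hne (mul_left_cancel₀ ha ((heval ⟨g, hg⟩).trans (congrArg (· * g y) hab.symm)))

namespace IsUEmbedding

variable {ι K : Type*} [Fintype ι] [TopologicalSpace K] [CompactSpace K] [T2Space K]
  {T : (ι → ℝ) →ₗᵢ[ℝ] C(K, ℝ)}

theorem eq_of_abs_apply_single_eq_one [DecidableEq ι] (hT : IsUEmbedding T) {i : ι}
    {x y : K} (hx : |T (Pi.single i 1) x| = 1) (hy : |T (Pi.single i 1) y| = 1) : x = y := by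
  have hne : T (Pi.single i 1) x ≠ 0 := abs_ne_zero.1 (hx.trans_ne one_ne_zero)
  exact eq_of_smul_evalCLM_eq hne <| (hT _ (norm_proj_eq_one i)).unique
    (isHahnBanachExtension_smul_evalCLM hx) (isHahnBanachExtension_smul_evalCLM hy)

theorem mem_gDeltaPoints [DecidableEq ι] (hT : IsUEmbedding T) {i : ι} {x : K}
    (hx : |T (Pi.single i 1) x| = 1) : x ∈ gDeltaPoints K := by
  have hpreimage : ({x} : Set K) = (fun y => |T (Pi.single i 1) y|) ⁻¹' {1} := by
    ext y
    exact ⟨fun h => h ▸ hx, fun hy => hT.eq_of_abs_apply_single_eq_one hy hx⟩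
  change IsGδ ({x} : Set K)
  rw [hpreimage]
  exact (IsGδ.singleton (1 : ℝ)).preimage (by fun_prop)

theorem nonempty_embedding_gDeltaPoints (hT : IsUEmbedding T) :
    Nonempty (ι ↪ gDeltaPoints K) := by
  classical
  choose p hp using exists_abs_apply_single_eq_one T
  refine ⟨fun i => ⟨p i, hT.mem_gDeltaPoints (hp i)⟩, fun i j hij => ?_⟩
  have hpij : p i = p j := congrArg Subtype.val hij
  exact index_eq_of_abs_apply_single_eq_one (hp i) (hpij ▸ hp j)

end IsUEmbedding

theorem uEmbeddable_pi_iff_nonempty_embedding {ι K : Type*} [Fintype ι] [TopologicalSpace K]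
    [CompactSpace K] [T2Space K] :
    UEmbeddable (ι → ℝ) C(K, ℝ) ↔ Nonempty (ι ↪ gDeltaPoints K) := by
  refine ⟨fun ⟨_, hT⟩ => hT.nonempty_embedding_gDeltaPoints, fun ⟨p⟩ => ?_⟩
  obtain ⟨f, hf⟩ := exists_isDisjointPeakFamily
    (Subtype.val_injective.comp p.injective) fun i => (p i).2
  exact ⟨hf.linearIsometry, hf.isUEmbedding_linearIsometry⟩

theorem natCast_le_encard_iff_nonempty_embedding {α : Type*} {s : Set α} {n : ℕ} :
    (n : ℕ∞) ≤ s.encard ↔ Nonempty (Fin n ↪ s) := by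
  rw [Set.encard, ENat.card, Cardinal.natCast_le_toENat, ← Cardinal.lift_mk_le']
  simp

theorem mainTheorem8 (N : ℕ) (K : Type*) [TopologicalSpace K] [CompactSpace K] [T2Space K] :
    UEmbeddable (Fin N → ℝ) C(K, ℝ) ↔ (N : ℕ∞) ≤ (gDeltaPoints K).encard := by
  rw [uEmbeddable_pi_iff_nonempty_embedding, natCast_le_encard_iff_nonempty_embedding]
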